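/- Throughout, a topological groupoid $\mathcal{G}$ is a groupoid with a topology for which multiplication and inversion are continuous; its unit space $\mathcal{G}^{(0)}$ carries the subspace topology, and $d, r\colon \mathcal{G} \to \mathcal{G}^{(0)}$ denote the source and range maps. A bisection is a subset of $\mathcal{G}$ on which $d$ and $r$ restrict to homeomorphisms onto their images. The groupoid $\mathcal{G}$ is ample if it is étale (that is, $d$ is a local homeomorphism) and its topology has a basis of compact open bisections. The orbit space is the set of orbits $\mathcal{G}^{(0)}/\mathcal{G}$ with the quotient topology, and $\mathcal{G}|_x = \{g \in \mathcal{G} \mid d(g) = r(g) = x\}$ is the isotropy group at $x \in \mathcal{G}^{(0)}$. For an ample Hausdorff groupoid $\mathcal{G}$, let $\Gamma(\mathcal{G})$ be the Boolean inverse semigroup of compact open bisections of $\mathcal{G}$ under the product $UV = \{gh \mid g \in U,\ h \in V,\ d(g) = r(h)\}$, with zero $\emptyset$. A corner of $\Gamma(\mathcal{G})$ is a subsemigroup $p\,\Gamma(\mathcal{G})\,p$ with $p \in \Gamma(\mathcal{G})$ idempotent. For a group $G$, let $G_0 = G \sqcup \{0\}$ be the group with an absorbing zero adjoined. For inverse semigroups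 with zero, write $s \le t$ if $s^*s \le t^*t$ and $t s^*s = s$ (where $e \le f$ means $ef = e$ for idempotents), and call $s, t$ orthogonal if $st^* = 0 = s^*t$. A morphism of Boolean inverse semigroups is a semigroup homomorphism that preserves zero and the joins (least upper bounds for $\le$) of orthogonal elements, and $C$ is a quotient of $B$ if there is a surjective such morphism $B \to C$. **Proposition.** 1. Let $\mathcal{G}$ be a second countable, ample Hausdorff groupoid whose orbit space is $\mathrm{T}_0$. Then for every unit $x \in \mathcal{G}^{(0)}$, the group with zero $(\mathcal{G}|_x)_0$ is a quotient of a corner of $\Gamma(\mathcal{G})$. 2. Let $\mathcal{G}$ be any ample Hausdorff groupoid and let $G$ be a group such that $G_0$ is a quotient of a corner of $\Gamma(\mathcal{G})$. Then there is a unit $x \in \mathcal{G}^{(0)}$ such that $G$ is a quotient of the isotropy group $\mathcal{G}|_x$, i.e. there is a surjective group homomorphism $\mathcal{G}|_x \to G$. -/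

import Mathlib

open CategoryTheory Topology

universe u v w

/-! ### Inverse semigroups -/

/-- A semigroup in which every `s` has a unique `t` with `s t s = s` and `t s t = t`. -/
class IsInverseSemigroup (S : Type*) [Semigroup S] : Prop where
  existsUnique_star : ∀ s : S, ∃! t : S, s * t * s = s ∧ t * s * t = t

namespace InverseSemigroup

section

variable {S : Type*} [Semigroup S] [IsInverseSemigroup S]

/-- The generalized inverse `s^*`. -/
noncomputable def star (s : S) : S :=
  (IsInverseSemigroup.existsUnique_star s).choose

theorem star_spec (s : S) : s * star s * s = s ∧ star s * s * star s = star s :=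
  (IsInverseSemigroup.existsUnique_star s).choose_spec.1

theorem eq_star {s t : S} (h₁ : s * t * s = s) (h₂ : t * s * t = t) : t = star s :=
  (IsInverseSemigroup.existsUnique_star s).choose_spec.2 t ⟨h₁, h₂⟩

/-- The support `s^* s`. -/
noncomputable def supp (s : S) : S := star s * s

/-- The natural partial order: `supp s ≤ supp t` (idempotents satisfy `e ≤ f` iff `e f = e`) and
`t (supp s) = s`. -/
def NatLE (s t : S) : Prop := supp s * supp t = supp s ∧ t * supp s = s

/-- `u` is the join, i.e. the least upper bound for the natural partial order, of `s` and `t`. -/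
def IsJoin (s t u : S) : Prop :=
  NatLE s u ∧ NatLE t u ∧ ∀ v : S, NatLE s v → NatLE t v → NatLE u v

end

/-- Orthogonality of elements of an inverse semigroup with zero. -/
def Orthogonal {S : Type*} [SemigroupWithZero S] [IsInverseSemigroup S] (s t : S) : Prop :=
  s * star t = 0 ∧ star s * t = 0

/-- Morphisms of Boolean inverse semigroups: semigroup homomorphisms preserving zero (the empty
join) and the join of any two orthogonal elements, hence all joins of finite orthogonal
families.  (A semigroup homomorphism automatically commutes with `star`.) -/
structure IsBooleanMorphism {B C : Type*} [SemigroupWithZero B] [IsInverseSemigroup B]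
    [SemigroupWithZero C] [IsInverseSemigroup C] (φ : B →ₙ* C) : Prop where
  map_zero : φ 0 = 0
  map_join : ∀ s t j : B, Orthogonal s t → IsJoin s t j →
    Orthogonal (φ s) (φ t) ∧ IsJoin (φ s) (φ t) (φ j)

/-- `C` is a quotient of `B`: there is a surjective morphism of Boolean inverse semigroups. -/
def IsQuotient (C B : Type*) [SemigroupWithZero B] [IsInverseSemigroup B]
    [SemigroupWithZero C] [IsInverseSemigroup C] : Prop :=
  ∃ φ : B →ₙ* C, IsBooleanMorphism φ ∧ Function.Surjective φ

/-- The subsemigroup `p B p` inherits the zero of `B`. -/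
instance cornerSemigroupWithZero {B : Type*} [SemigroupWithZero B] (p : B) :
    SemigroupWithZero (Subsemigroup.corner p) where
  zero := ⟨0, 0, by simp⟩
  zero_mul _ := Subtype.ext (zero_mul _)
  mul_zero _ := Subtype.ext (mul_zero _)

theorem isInverseSemigroup_corner {B : Type*} [SemigroupWithZero B] [IsInverseSemigroup B] {p : B}
    (hp : IsIdempotentElem p) : IsInverseSemigroup (Subsemigroup.corner p) where
  existsUnique_star := by
    rintro ⟨s, hs⟩
    obtain ⟨h₁, h₂⟩ := (Subsemigroup.mem_corner_iff hp).1 hs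
    obtain ⟨k₁, k₂⟩ := star_spec s
    refine ⟨⟨p * star s * p, star s, rfl⟩, ⟨Subtype.ext ?_, Subtype.ext ?_⟩, ?_⟩
    · change s * (p * star s * p) * s = s
      calc s * (p * star s * p) * s = (s * p) * star s * (p * s) := by simp only [mul_assoc]
        _ = s := by rw [h₁, h₂, k₁]
    · change p * star s * p * s * (p * star s * p) = p * star s * p
      calc p * star s * p * s * (p * star s * p)
          = p * (star s * ((p * s) * p) * star s) * p := by simp only [mul_assoc]
        _ = p * star s * p := by rw [h₁, h₂, k₂]
    · rintro ⟨t, ht⟩ ⟨e₁, e₂⟩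
      have e := eq_star (congrArg Subtype.val e₁) (congrArg Subtype.val e₂)
      obtain ⟨l₁, l₂⟩ := (Subsemigroup.mem_corner_iff hp).1 ht
      refine Subtype.ext ?_
      change t = p * star s * p
      rw [← e]
      change t = p * t * p
      rw [l₁, l₂]

/-- `C` is a quotient of a corner `p B p` of `B`, for some idempotent `p` of `B`. -/
def IsQuotientOfCorner (C B : Type*) [SemigroupWithZero B] [IsInverseSemigroup B]
    [SemigroupWithZero C] [IsInverseSemigroup C] : Prop :=
  ∃ (p : B) (hp : IsIdempotentElem p),
    haveI := isInverseSemigroup_corner hp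
    IsQuotient C (Subsemigroup.corner p)

/-- The group with zero `G₀` is an inverse semigroup. -/
instance isInverseSemigroup_withZero (G : Type*) [Group G] : IsInverseSemigroup (WithZero G) where
  existsUnique_star s := by
    refine ⟨s⁻¹, ?_, ?_⟩
    · rcases eq_or_ne s 0 with rfl | hs
      · simp
      · simp [hs]
    rintro t ⟨h₁, h₂⟩
    rcases eq_or_ne s 0 with rfl | hs
    · simpa using h₂.symm
    · have : t * s = 1 := mul_left_cancel₀ hs (by rw [← mul_assoc, h₁, mul_one])
      exact eq_inv_of_mul_eq_one_left this

end InverseSemigroup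

/-! ### Ample groupoids -/

namespace AmpleGroupoid

/-- The set of all arrows of a groupoid with set of units `X`. -/
abbrev Arrows (X : Type u) [Groupoid.{v} X] := Quiver.Total X

section

variable {X : Type u} [Groupoid.{v} X]

/-- The source map `d`. -/
abbrev d (g : Arrows X) : X := g.left

/-- The range map `r`. -/
abbrev r (g : Arrows X) : X := g.right

/-- The unit arrow at `x`. -/
def unit (x : X) : Arrows X := ⟨x, x, 𝟙 x⟩

/-- The inverse of an arrow. -/
def inv (g : Arrows X) : Arrows X := ⟨g.right, g.left, Groupoid.inv g.hom⟩

/-- The product `g h`, i.e. `g` after `h`, defined when `d g = r h`. -/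
def comp (g h : Arrows X) (e : d g = r h) : Arrows X :=
  ⟨h.left, g.right, h.hom ≫ eqToHom e.symm ≫ g.hom⟩

theorem comp_mk {a b c : X} (f : b ⟶ c) (f' : a ⟶ b) (e : b = b) :
    comp (⟨b, c, f⟩ : Arrows X) ⟨a, b, f'⟩ e = ⟨a, c, f' ≫ f⟩ := by
  simp [comp]

theorem inv_mk {a b : X} (f : a ⟶ b) :
    inv (⟨a, b, f⟩ : Arrows X) = ⟨b, a, Groupoid.inv f⟩ := rfl

@[simp] theorem d_inv (g : Arrows X) : d (inv g) = r g := rfl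
@[simp] theorem r_inv (g : Arrows X) : r (inv g) = d g := rfl
@[simp] theorem d_comp (g h : Arrows X) (e) : d (comp g h e) = d h := rfl
@[simp] theorem r_comp (g h : Arrows X) (e) : r (comp g h e) = r g := rfl

@[simp] theorem inv_inv (g : Arrows X) : inv (inv g) = g := by
  rcases g with ⟨a, b, f⟩
  simp [inv]

theorem comp_assoc (g h k : Arrows X) (e : d g = r h) (e' : d h = r k) :
    comp (comp g h e) k e' = comp g (comp h k e') e := by
  rcases g with ⟨a, b, f⟩
  rcases h with ⟨a', b', f'⟩
  rcases k with ⟨a'', b'', f''⟩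
  obtain rfl : a = b' := e
  obtain rfl : a' = b'' := e'
  simp only [comp_mk, Category.assoc]

theorem comp_inv_comp (g h : Arrows X) (e : d g = d h) :
    comp (comp g (inv h) e) h rfl = g := by
  rcases g with ⟨a, b, f⟩
  rcases h with ⟨a', b', f'⟩
  obtain rfl : a = a' := e
  simp [comp_mk, inv_mk]

theorem comp_comp_inv (g h : Arrows X) (e : d g = r h) :
    comp (comp g h e) (inv h) rfl = g := by
  rcases g with ⟨a, b, f⟩
  rcases h with ⟨a', b', f'⟩
  obtain rfl : a = b' := e
  simp [comp_mk, inv_mk]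

theorem comp_inv_self_comp (g : Arrows X) : comp (comp g (inv g) rfl) g rfl = g :=
  comp_inv_comp g g rfl

theorem eq_inv_of_comp_comp (k s : Arrows X) (e : d k = r s) (e' : d s = r k)
    (h : comp (comp k s e) k e' = k) : s = inv k := by
  rcases k with ⟨a, b, f⟩
  rcases s with ⟨a', b', f'⟩
  obtain rfl : a = b' := e
  obtain rfl : a' = b := e'
  simp only [comp_mk, Quiver.Total.mk.injEq, heq_eq_eq, true_and] at h
  have h' : f' ≫ f = 𝟙 _ := by
    have := congrArg (fun z => Groupoid.inv f ≫ z) h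
    simpa using this
  have : f' = Groupoid.inv f := by
    have := congrArg (fun z => z ≫ Groupoid.inv f) h'
    simpa using this
  simp [inv, this]

/-- The pointwise product of sets of arrows. -/
def setMul (U V : Set (Arrows X)) : Set (Arrows X) :=
  {k | ∃ g ∈ U, ∃ h ∈ V, ∃ e : d g = r h, comp g h e = k}

theorem setMul_assoc (U V W : Set (Arrows X)) :
    setMul (setMul U V) W = setMul U (setMul V W) := by
  ext k
  constructor
  · rintro ⟨_, ⟨g, hg, h, hh, e, rfl⟩, l, hl, e', rfl⟩
    exact ⟨g, hg, _, ⟨h, hh, l, hl, e', rfl⟩, e, (comp_assoc g h l e e').symm⟩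
  · rintro ⟨g, hg, _, ⟨h, hh, l, hl, e', rfl⟩, e, rfl⟩
    exact ⟨_, ⟨g, hg, h, hh, e, rfl⟩, l, hl, e', comp_assoc g h l e e'⟩

end

/-- A topological groupoid: multiplication and inversion are continuous, and the topology of the
unit space is the one inherited from the space of arrows. -/
class IsTopologicalGroupoid (X : Type u) [Groupoid.{v} X] [TopologicalSpace X]
    [TopologicalSpace (Arrows X)] : Prop where
  isEmbedding_unit : IsEmbedding (unit : X → Arrows X)
  continuous_inv : Continuous (inv : Arrows X → Arrows X)
  continuous_comp : Continuous
    fun q : {q : Arrows X × Arrows X // d q.1 = r q.2} => comp q.1.1 q.1.2 q.2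

/-- A bisection: `d` and `r` restrict to homeomorphisms onto their images. -/
def IsBisection {X : Type u} [Groupoid.{v} X] [TopologicalSpace X]
    [TopologicalSpace (Arrows X)] (U : Set (Arrows X)) : Prop :=
  IsEmbedding (U.domRestrict d) ∧ IsEmbedding (U.domRestrict r)

/-- An ample groupoid: an étale topological groupoid (the source map is a local homeomorphism)
whose topology has a basis of compact open bisections. -/
class IsAmple (X : Type u) [Groupoid.{v} X] [TopologicalSpace X]
    [TopologicalSpace (Arrows X)] : Prop extends IsTopologicalGroupoid X where
  isLocalHomeomorph_d : IsLocalHomeomorph (d : Arrows X → X)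
  isTopologicalBasis : TopologicalSpace.IsTopologicalBasis
    {U : Set (Arrows X) | IsCompact U ∧ IsOpen U ∧ IsBisection U}

/-- The set `Γ` of compact open bisections. -/
@[ext]
structure Gamma (X : Type u) [Groupoid.{v} X] [TopologicalSpace X]
    [TopologicalSpace (Arrows X)] where
  carrier : Set (Arrows X)
  isCompact : IsCompact carrier
  isOpen : IsOpen carrier
  isBisection : IsBisection carrier

section

variable {X : Type u} [Groupoid.{v} X] [TopologicalSpace X] [TopologicalSpace (Arrows X)]

theorem IsBisection.injOn_d {U : Set (Arrows X)} (h : IsBisection U) : Set.InjOn d U :=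
  Set.injOn_iff_injective.2 h.1.injective

theorem IsBisection.injOn_r {U : Set (Arrows X)} (h : IsBisection U) : Set.InjOn r U :=
  Set.injOn_iff_injective.2 h.2.injective

theorem isBisection_empty : IsBisection (∅ : Set (Arrows X)) :=
  ⟨.of_subsingleton _, .of_subsingleton _⟩

variable [IsAmple X]

theorem continuous_inv : Continuous (inv : Arrows X → Arrows X) :=
  IsTopologicalGroupoid.continuous_inv

theorem continuous_d : Continuous (d : Arrows X → X) :=
  IsAmple.isLocalHomeomorph_d.continuous

theorem isOpenMap_d : IsOpenMap (d : Arrows X → X) :=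
  IsAmple.isLocalHomeomorph_d.isOpenMap

theorem continuous_r : Continuous (r : Arrows X → X) :=
  continuous_d.comp continuous_inv

theorem isOpenMap_r : IsOpenMap (r : Arrows X → X) := by
  have h : IsOpenMap (inv : Arrows X → Arrows X) :=
    IsOpenMap.of_inverse continuous_inv inv_inv inv_inv
  exact isOpenMap_d.comp h

theorem isBisection_of_injOn {U : Set (Arrows X)} (hU : IsOpen U) (h₁ : Set.InjOn d U)
    (h₂ : Set.InjOn r U) : IsBisection U :=
  ⟨(IsOpenEmbedding.of_continuous_injective_isOpenMap
      (continuous_d.comp continuous_subtype_val) (Set.injOn_iff_injective.1 h₁)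
      (isOpenMap_d.domRestrict hU)).isEmbedding,
   (IsOpenEmbedding.of_continuous_injective_isOpenMap
      (continuous_r.comp continuous_subtype_val) (Set.injOn_iff_injective.1 h₂)
      (isOpenMap_r.domRestrict hU)).isEmbedding⟩

theorem isOpen_setMul {U V : Set (Arrows X)} (hU : IsOpen U) (hV : IsOpen V) :
    IsOpen (setMul U V) := by
  have hc : Continuous fun q : {q : Arrows X × Arrows X // d q.1 = d q.2} =>
      comp q.1.1 (inv q.1.2) q.2 := by
    have h : Continuous fun q : {q : Arrows X × Arrows X // d q.1 = d q.2} =>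
        (⟨(q.1.1, inv q.1.2), q.2⟩ : {q : Arrows X × Arrows X // d q.1 = r q.2}) :=
      Continuous.subtype_mk ((continuous_fst.comp continuous_subtype_val).prodMk
        (continuous_inv.comp (continuous_snd.comp continuous_subtype_val))) _
    exact (IsTopologicalGroupoid.continuous_comp (X := X)).comp h
  rw [isOpen_iff_mem_nhds]
  rintro _ ⟨g, hg, h, hh, e, rfl⟩
  have hW := (hU.preimage hc).inter
    (hV.preimage (continuous_snd.comp continuous_subtype_val))
  obtain ⟨W', hW', hW'e⟩ := isOpen_induced_iff.1 hW
  have hmem : (comp g h e, h) ∈ W' := by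
    have : (⟨(comp g h e, h), rfl⟩ : {q : Arrows X × Arrows X // d q.1 = d q.2}) ∈
        Subtype.val ⁻¹' W' := by
      rw [hW'e]
      refine ⟨?_, hh⟩
      change comp (comp g h e) (inv h) rfl ∈ U
      rwa [comp_comp_inv]
    exact this
  obtain ⟨A, B, hA, hB, hgA, hhB, hAB⟩ := isOpen_prod_iff.1 hW' _ _ hmem
  refine Filter.mem_of_superset ((hA.inter ((isOpenMap_d B hB).preimage continuous_d)).mem_nhds
    ⟨hgA, h, hhB, rfl⟩) ?_
  rintro k ⟨hkA, l, hlB, hl⟩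
  have : (⟨(k, l), hl.symm⟩ : {q : Arrows X × Arrows X // d q.1 = d q.2}) ∈
      Subtype.val ⁻¹' W' := hAB ⟨hkA, hlB⟩
  rw [hW'e] at this
  exact ⟨_, this.1, l, this.2, rfl, comp_inv_comp k l hl.symm⟩

theorem isCompact_setMul [T2Space (Arrows X)] {U V : Set (Arrows X)} (hU : IsCompact U)
    (hV : IsCompact V) : IsCompact (setMul U V) := by
  have : T2Space X := (IsTopologicalGroupoid.isEmbedding_unit (X := X)).t2Space
  have hcl : IsClosed {q : Arrows X × Arrows X | d q.1 = r q.2} :=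
    isClosed_eq (continuous_d.comp continuous_fst) (continuous_r.comp continuous_snd)
  have hK : IsCompact ((Subtype.val : {q : Arrows X × Arrows X // d q.1 = r q.2} → _) ⁻¹'
      (U ×ˢ V)) := hcl.isClosedEmbedding_subtypeVal.isCompact_preimage (hU.prod hV)
  convert hK.image (IsTopologicalGroupoid.continuous_comp (X := X)) using 1
  ext k
  constructor
  · rintro ⟨g, hg, h, hh, e, rfl⟩
    exact ⟨⟨(g, h), e⟩, ⟨hg, hh⟩, rfl⟩
  · rintro ⟨⟨⟨g, h⟩, e⟩, ⟨hg, hh⟩, rfl⟩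
    exact ⟨g, hg, h, hh, e, rfl⟩

theorem isBisection_setMul {U V : Set (Arrows X)} (oU : IsOpen U) (oV : IsOpen V)
    (hU : IsBisection U) (hV : IsBisection V) : IsBisection (setMul U V) := by
  refine isBisection_of_injOn (isOpen_setMul oU oV) ?_ ?_
  · rintro _ ⟨g, hg, h, hh, e, rfl⟩ _ ⟨g', hg', h', hh', e', rfl⟩ hd
    obtain rfl : h = h' := hV.injOn_d hh hh' hd
    obtain rfl : g = g' := hU.injOn_d hg hg' (e.trans e'.symm)
    rfl
  · rintro _ ⟨g, hg, h, hh, e, rfl⟩ _ ⟨g', hg', h', hh', e', rfl⟩ hr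
    obtain rfl : g = g' := hU.injOn_r hg hg' hr
    obtain rfl : h = h' := hV.injOn_r hh hh' (e.symm.trans e')
    rfl

/-- The pointwise inverse of a compact open bisection. -/
def gammaInv (U : Gamma X) : Gamma X where
  carrier := inv ⁻¹' U.carrier
  isCompact := by
    have h : inv ⁻¹' U.carrier = inv '' U.carrier := by
      ext g
      exact ⟨fun hg => ⟨inv g, hg, inv_inv g⟩, by
        rintro ⟨k, hk, rfl⟩
        simpa using hk⟩
    rw [h]
    exact U.isCompact.image continuous_inv
  isOpen := U.isOpen.preimage continuous_inv
  isBisection := by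
    refine isBisection_of_injOn (U.isOpen.preimage continuous_inv) ?_ ?_
    · intro g hg h hh e
      have : inv g = inv h := U.isBisection.injOn_r hg hh e
      rw [← inv_inv g, this, inv_inv]
    · intro g hg h hh e
      have : inv g = inv h := U.isBisection.injOn_d hg hh e
      rw [← inv_inv g, this, inv_inv]

theorem gammaInv_gammaInv (U : Gamma X) : gammaInv (gammaInv U) = U :=
  Gamma.ext (Set.ext fun g => by simp [gammaInv])

variable [T2Space (Arrows X)]

/-- `Γ` is a semigroup under the pointwise product, with zero the empty bisection. -/
instance : SemigroupWithZero (Gamma X) where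
  mul U V := ⟨setMul U.carrier V.carrier, isCompact_setMul U.isCompact V.isCompact,
    isOpen_setMul U.isOpen V.isOpen,
    isBisection_setMul U.isOpen V.isOpen U.isBisection V.isBisection⟩
  mul_assoc _ _ _ := Gamma.ext (setMul_assoc _ _ _)
  zero := ⟨∅, isCompact_empty, isOpen_empty, isBisection_empty⟩
  zero_mul _ := Gamma.ext (Set.eq_empty_of_forall_notMem fun _ ⟨_, hg, _⟩ => hg)
  mul_zero _ := Gamma.ext (Set.eq_empty_of_forall_notMem fun _ ⟨_, _, _, hh, _⟩ => hh)

theorem carrier_mul (U V : Gamma X) : (U * V).carrier = setMul U.carrier V.carrier := rfl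

theorem carrier_zero : (0 : Gamma X).carrier = ∅ := rfl

theorem mul_gammaInv_mul (U : Gamma X) : U * gammaInv U * U = U := by
  refine Gamma.ext (Set.ext fun k => ?_)
  constructor
  · rintro ⟨_, ⟨g, hg, h, hh, e, rfl⟩, l, hl, e', rfl⟩
    have h₁ : inv h = g := U.isBisection.injOn_d hh hg e.symm
    have h₂ : l = inv h := U.isBisection.injOn_r hl hh e'.symm
    subst h₂ h₁
    have := comp_inv_comp (inv h) (inv h) rfl
    simp only [inv_inv] at this
    rwa [this]
  · intro hk
    exact ⟨_, ⟨k, hk, inv k, by simpa [gammaInv] using hk, rfl, rfl⟩, k, hk, rfl,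
      comp_inv_self_comp k⟩

theorem inv_mem_of_mul_mul {U V : Gamma X} (h : V * U * V = V) {k : Arrows X}
    (hk : k ∈ V.carrier) : inv k ∈ U.carrier := by
  have hk' := hk
  rw [← h] at hk'
  obtain ⟨_, ⟨t, ht, s, hs, e, rfl⟩, t', ht', e', h'⟩ := hk'
  have h₁ : t' = k := V.isBisection.injOn_d ht' hk (by rw [← h']; rfl)
  have h₂ : t = k := V.isBisection.injOn_r ht hk (by rw [← h']; rfl)
  subst h₁ h₂
  rwa [← eq_inv_of_comp_comp _ s e e' h']

/-- `Γ` is an inverse semigroup. -/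
instance : IsInverseSemigroup (Gamma X) where
  existsUnique_star U := by
    refine ⟨gammaInv U, ⟨mul_gammaInv_mul U, ?_⟩, ?_⟩
    · simpa only [gammaInv_gammaInv] using mul_gammaInv_mul (gammaInv U)
    · rintro V ⟨h₁, h₂⟩
      refine Gamma.ext (Set.ext fun k => ⟨fun hk => inv_mem_of_mul_mul h₂ hk, fun hk => ?_⟩)
      simpa using inv_mem_of_mul_mul h₁ (k := inv k) hk

end

/-- The orbit space, with the quotient topology: two units are identified when there is an arrow
(equivalently, an isomorphism) between them. -/
abbrev OrbitSpace (X : Type u) [Groupoid.{v} X] := Quotient (isIsomorphicSetoid X)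

/-- The isotropy group at `x`: all arrows from `x` to `x`, with `g * h` being `g` after `h`. -/
abbrev Isotropy {X : Type u} [Groupoid.{v} X] (x : X) := Aut x

end AmpleGroupoid

/-! Part 1 is a Baire category argument. The orbit of `x` is countable, and its closure `C` is
locally compact Hausdorff, hence Baire. If no point of the orbit were relatively isolated, each
orbit point would have dense open complement in `C`. The saturation of any neighbourhood of `x` is
also open and dense there, since it contains the orbit. Some `c` in `C` then lies off the orbit, yet
every neighbourhood of `x` meets the orbit of `c`. The two orbits are inseparable, against `T₀`. So
some orbit point is isolated (`exists_isolated_mem_orbit`), and a bisection carries this to `x`: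
there is a compact open `A` meeting the orbit only in `x`. In the corner at `A`, sending a bisection
to its arrow from `x` to `x`, or to `0` if there is none, is the required quotient map.

Part 2 is Stone duality followed by germs. The idempotents of the corner are the compact open
subsets of `A`. Those not killed by the morphism `φ` form an ultrafilter, which by compactness is
given by a point `x` (`exists_point_of_isBooleanMorphism`). Then `φ V ≠ 0` exactly when `x` is a
source of `V`, and in that case `V` contains an isotropy arrow at `x`. As distinct nonzero elements
of a group with zero are incomparable, `φ V` depends only on that arrow. This gives the homomorphism
onto `G`. -/

namespace InverseSemigroup

/-! ### Corners, morphisms and the order on a group with zero -/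

section Corner

variable {B : Type*} [SemigroupWithZero B] [IsInverseSemigroup B] {p : B}

theorem coe_star_corner (hp : IsIdempotentElem p) (s : Subsemigroup.corner p) :
    haveI := isInverseSemigroup_corner hp
    (star s : Subsemigroup.corner p).1 = star s.1 := by
  have := isInverseSemigroup_corner hp
  have h := star_spec s
  exact eq_star (congrArg Subtype.val h.1) (congrArg Subtype.val h.2)

theorem coe_supp_corner (hp : IsIdempotentElem p) (s : Subsemigroup.corner p) :
    haveI := isInverseSemigroup_corner hp
    (supp s : Subsemigroup.corner p).1 = supp s.1 := by
  have := isInverseSemigroup_corner hp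
  exact congrArg (· * s.1) (coe_star_corner hp s)

theorem natLE_corner_iff (hp : IsIdempotentElem p) (s t : Subsemigroup.corner p) :
    haveI := isInverseSemigroup_corner hp
    NatLE s t ↔ NatLE s.1 t.1 := by
  have := isInverseSemigroup_corner hp
  unfold NatLE
  rw [Subtype.ext_iff, Subtype.ext_iff, ← coe_supp_corner hp s, ← coe_supp_corner hp t]
  rfl

end Corner

section Morphism

variable {B C : Type*} [SemigroupWithZero B] [IsInverseSemigroup B]
  [SemigroupWithZero C] [IsInverseSemigroup C]

theorem map_star (φ : B →ₙ* C) (s : B) : φ (star s) = star (φ s) := by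
  refine eq_star ?_ ?_
  · rw [← map_mul, ← map_mul, (star_spec s).1]
  · rw [← map_mul, ← map_mul, (star_spec s).2]

theorem map_supp (φ : B →ₙ* C) (s : B) : φ (supp s) = supp (φ s) := by
  rw [supp, map_mul, map_star, supp]

theorem NatLE.map (φ : B →ₙ* C) {s t : B} (h : NatLE s t) : NatLE (φ s) (φ t) := by
  refine ⟨?_, ?_⟩
  · rw [← map_supp, ← map_supp, ← map_mul, h.1]
  · rw [← map_supp, ← map_mul, h.2]

theorem Orthogonal.map (φ : B →ₙ* C) (h0 : φ 0 = 0) {s t : B} (h : Orthogonal s t) :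
    Orthogonal (φ s) (φ t) := by
  refine ⟨?_, ?_⟩
  · rw [← map_star, ← map_mul, h.1, h0]
  · rw [← map_star, ← map_mul, h.2, h0]

end Morphism

section GroupWithZero

variable {G : Type*} [Group G]

theorem star_withZero (a : WithZero G) : star a = a⁻¹ := by
  refine (eq_star ?_ ?_).symm <;> rcases eq_or_ne a 0 with rfl | h <;> simp [*]

theorem supp_withZero {a : WithZero G} (h : a ≠ 0) : supp a = 1 := by
  rw [supp, star_withZero, inv_mul_cancel₀ h]

theorem supp_zero_withZero : supp (0 : WithZero G) = 0 := by
  rw [supp, mul_zero]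

/-- The order on a group with zero is flat, because every nonzero element has support `1`. -/
theorem NatLE.eq_of_ne_zero {a b : WithZero G} (h : NatLE a b) (ha : a ≠ 0) : b = a := by
  have := h.2
  rwa [supp_withZero ha, mul_one] at this

theorem zero_natLE (b : WithZero G) : NatLE 0 b := by
  constructor <;> simp [supp_zero_withZero]

theorem natLE_rfl (b : WithZero G) : NatLE b b := by
  rcases eq_or_ne b 0 with rfl | h
  · exact zero_natLE 0
  · constructor <;> simp [supp_withZero h]

theorem NatLE.eq_zero {a : WithZero G} (h : NatLE a 0) : a = 0 := by
  simpa using h.2.symm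

/-- A multiplicative map to a group with zero preserves orthogonal joins as soon as the join of
two elements of the kernel lies in the kernel. -/
theorem isBooleanMorphism_withZero {B : Type*} [SemigroupWithZero B] [IsInverseSemigroup B]
    (φ : B →ₙ* WithZero G) (h0 : φ 0 = 0)
    (h : ∀ s t j : B, Orthogonal s t → IsJoin s t j → φ s = 0 → φ t = 0 → φ j = 0) :
    IsBooleanMorphism φ := by
  refine ⟨h0, fun s t j ho hj => ⟨ho.map φ h0, hj.1.map φ, hj.2.1.map φ, fun v hs ht => ?_⟩⟩
  -- A nonzero image of `s` or `t` lies below `φ j`, hence equals it, and leastness is automatic.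
  -- Only the kernel case needs the hypothesis `h`.
  by_cases h₁ : φ s = 0
  · by_cases h₂ : φ t = 0
    · rw [h s t j ho hj h₁ h₂]
      exact zero_natLE v
    · rwa [(hj.2.1.map φ).eq_of_ne_zero h₂]
  · rwa [(hj.1.map φ).eq_of_ne_zero h₁]

end GroupWithZero

end InverseSemigroup

namespace AmpleGroupoid

open InverseSemigroup

/-! ### Arrows and isotropy groups -/

section

variable {X : Type u} [Groupoid.{v} X]

@[simp] theorem comp_unit (g : Arrows X) (x : X) (e : d g = r (unit x)) :
    comp g (unit x) e = g := by
  rcases g with ⟨a, b, f⟩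
  obtain rfl : a = x := e
  simp [unit, comp_mk]

@[simp] theorem unit_comp (g : Arrows X) (x : X) (e : d (unit x) = r g) :
    comp (unit x) g e = g := by
  rcases g with ⟨a, b, f⟩
  obtain rfl : x = b := e
  simp [unit, comp_mk]

theorem inv_comp_self (g : Arrows X) : comp (inv g) g rfl = unit (d g) := by
  rcases g with ⟨a, b, f⟩
  simp [unit, inv_mk, comp_mk]

theorem eq_unit_of_comp_eq (g h : Arrows X) (e : d g = r h) (he : comp g h e = h) :
    g = unit (r h) := by
  rw [← comp_comp_inv g h e]
  simp only [he]
  rcases h with ⟨a, b, f⟩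
  simp [unit, inv_mk, comp_mk]

/-- An element of the isotropy group, as an arrow. -/
def isotropyArrow {x : X} (g : Isotropy x) : Arrows X := ⟨x, x, g.hom⟩

theorem isotropyArrow_injective (x : X) :
    Function.Injective (isotropyArrow : Isotropy x → Arrows X) := by
  intro g h e
  simp only [isotropyArrow, Quiver.Total.mk.injEq, heq_eq_eq, true_and] at e
  exact Iso.ext e

theorem isotropyArrow_mul {x : X} (g h : Isotropy x) :
    isotropyArrow (g * h) = comp (isotropyArrow g) (isotropyArrow h) rfl := by
  exact (comp_mk g.hom h.hom rfl).symm

theorem exists_isotropyArrow_eq {x : X} {k : Arrows X} (hd : d k = x) (hr : r k = x) :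
    ∃ g : Isotropy x, isotropyArrow g = k := by
  rcases k with ⟨a, b, f⟩
  obtain rfl : a = x := hd
  obtain rfl : b = a := hr
  exact ⟨(Groupoid.isoEquivHom _ _).symm f, rfl⟩

theorem nonempty_iso_iff {x y : X} : Nonempty (x ≅ y) ↔ ∃ k : Arrows X, d k = x ∧ r k = y := by
  constructor
  · rintro ⟨f⟩
    exact ⟨⟨x, y, f.hom⟩, rfl, rfl⟩
  · rintro ⟨⟨a, b, f⟩, rfl, rfl⟩
    exact ⟨(Groupoid.isoEquivHom _ _).symm f⟩

end

/-! ### Units, idempotents, order and joins of compact open bisections -/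

section

variable {X : Type u} [Groupoid.{v} X] [TopologicalSpace X] [TopologicalSpace (Arrows X)]
  [IsAmple X]

/-- The unit map is a continuous section of the local homeomorphism `d`, hence itself a local
homeomorphism. -/
theorem isOpenEmbedding_unit : IsOpenEmbedding (unit : X → Arrows X) := by
  have hc := (IsTopologicalGroupoid.isEmbedding_unit (X := X))
  have h : IsLocalHomeomorph ((d : Arrows X → X) ∘ unit) :=
    (Homeomorph.refl X).isLocalHomeomorph
  exact (IsLocalHomeomorph.of_comp h IsAmple.isLocalHomeomorph_d
    hc.continuous).isOpenEmbedding_of_injective hc.injective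

theorem exists_gamma_mem_subset {N : Set (Arrows X)} (hN : IsOpen N) {k : Arrows X} (hk : k ∈ N) :
    ∃ V : Gamma X, k ∈ V.carrier ∧ V.carrier ⊆ N := by
  obtain ⟨W, ⟨h₁, h₂, h₃⟩, hkW, hWN⟩ :=
    (IsAmple.isTopologicalBasis (X := X)).exists_subset_of_mem_open hk hN
  exact ⟨⟨W, h₁, h₂, h₃⟩, hkW, hWN⟩

theorem exists_isCompact_isOpen_subset {N : Set X} (hN : IsOpen N) {x : X} (hx : x ∈ N) :
    ∃ A : Set X, IsCompact A ∧ IsOpen A ∧ x ∈ A ∧ A ⊆ N := by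
  have hu := isOpenEmbedding_unit (X := X)
  obtain ⟨V, hxV, hVN⟩ :=
    exists_gamma_mem_subset (hu.isOpenMap N hN) (Set.mem_image_of_mem unit hx)
  refine ⟨unit ⁻¹' V.carrier, ?_, V.isOpen.preimage hu.continuous, hxV, ?_⟩
  · rw [hu.isEmbedding.isCompact_iff, Set.image_preimage_eq_of_subset
      (hVN.trans (Set.image_subset_range _ _))]
    exact V.isCompact
  · intro y hy
    obtain ⟨z, hz, e⟩ := hVN hy
    rwa [← hu.injective e]

variable (X) in
theorem locallyCompactSpace_units : LocallyCompactSpace X where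
  local_compact_nhds x n hn := by
    obtain ⟨N, hNn, hN, hx⟩ := mem_nhds_iff.1 hn
    obtain ⟨A, hAc, hAo, hxA, hAN⟩ := exists_isCompact_isOpen_subset hN hx
    exact ⟨A, hAo.mem_nhds hxA, hAN.trans hNn, hAc⟩

/-- A compact open set of units, as a compact open bisection. -/
def unitGamma (A : Set X) (hc : IsCompact A) (ho : IsOpen A) : Gamma X where
  carrier := unit '' A
  isCompact := hc.image isOpenEmbedding_unit.continuous
  isOpen := isOpenEmbedding_unit.isOpenMap A ho
  isBisection := isBisection_of_injOn (isOpenEmbedding_unit.isOpenMap A ho)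
    (by rintro _ ⟨x, _, rfl⟩ _ ⟨y, _, rfl⟩ (rfl : x = y); rfl)
    (by rintro _ ⟨x, _, rfl⟩ _ ⟨y, _, rfl⟩ (rfl : x = y); rfl)

variable [T2Space (Arrows X)]

theorem mem_unitGamma_mul {A : Set X} {hc : IsCompact A} {ho : IsOpen A} {V : Gamma X}
    {k : Arrows X} : k ∈ (unitGamma A hc ho * V).carrier ↔ k ∈ V.carrier ∧ r k ∈ A := by
  constructor
  · rintro ⟨_, ⟨x, hx, rfl⟩, h, hh, e, rfl⟩
    rw [unit_comp]
    exact ⟨hh, (show x = r h from e) ▸ hx⟩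
  · rintro ⟨hk, hA⟩
    exact ⟨_, ⟨_, hA, rfl⟩, k, hk, rfl, unit_comp k _ _⟩

theorem mem_mul_unitGamma {A : Set X} {hc : IsCompact A} {ho : IsOpen A} {V : Gamma X}
    {k : Arrows X} : k ∈ (V * unitGamma A hc ho).carrier ↔ k ∈ V.carrier ∧ d k ∈ A := by
  constructor
  · rintro ⟨h, hh, _, ⟨x, hx, rfl⟩, e, rfl⟩
    rw [comp_unit]
    exact ⟨hh, (show d h = x from e) ▸ hx⟩
  · rintro ⟨hk, hA⟩
    exact ⟨k, hk, _, ⟨_, hA, rfl⟩, rfl, comp_unit k _ _⟩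

theorem isIdempotentElem_unitGamma (A : Set X) (hc : IsCompact A) (ho : IsOpen A) :
    IsIdempotentElem (unitGamma A hc ho) := by
  refine Gamma.ext (Set.ext fun k => mem_unitGamma_mul.trans (and_iff_left_of_imp ?_))
  rintro ⟨x, hx, rfl⟩
  exact hx

theorem exists_eq_unitGamma {p : Gamma X} (hp : IsIdempotentElem p) :
    ∃ (A : Set X) (hc : IsCompact A) (ho : IsOpen A), p = unitGamma A hc ho := by
  have hu := isOpenEmbedding_unit (X := X)
  have hr : p.carrier ⊆ Set.range unit := by
    intro k hk
    have hk' : k ∈ (p * p).carrier := by rwa [hp.eq]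
    obtain ⟨g, hg, h, hh, e, he⟩ := hk'
    -- In a factorization `k = g h` inside `p`, injectivity of `d` and `r` forces `g = h = k`. So `k
    -- k = k`, and `k` is a unit.
    obtain rfl : h = k := p.isBisection.injOn_d hh hk (show d (comp g h e) = d k by rw [he])
    obtain rfl : g = h := p.isBisection.injOn_r hg hk (show r (comp g h e) = r h by rw [he])
    exact ⟨_, (eq_unit_of_comp_eq _ _ e he).symm⟩
  have he := Set.image_preimage_eq_of_subset hr
  refine ⟨unit ⁻¹' p.carrier, ?_, p.isOpen.preimage hu.continuous, Gamma.ext he.symm⟩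
  rw [hu.isEmbedding.isCompact_iff, he]
  exact p.isCompact

theorem mem_corner_unitGamma {A : Set X} {hc : IsCompact A} {ho : IsOpen A} {V : Gamma X} :
    V ∈ Subsemigroup.corner (unitGamma A hc ho) ↔ ∀ k ∈ V.carrier, d k ∈ A ∧ r k ∈ A := by
  rw [Subsemigroup.mem_corner_iff (isIdempotentElem_unitGamma A hc ho)]
  constructor
  · rintro ⟨h₁, h₂⟩ k hk
    exact ⟨(mem_mul_unitGamma.1 (h₂.symm ▸ hk)).2, (mem_unitGamma_mul.1 (h₁.symm ▸ hk)).2⟩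
  · intro h
    exact ⟨Gamma.ext (Set.ext fun k => mem_unitGamma_mul.trans
        (and_iff_left_of_imp fun hk => (h k hk).2)),
      Gamma.ext (Set.ext fun k => mem_mul_unitGamma.trans
        (and_iff_left_of_imp fun hk => (h k hk).1))⟩

theorem exists_corner_mem_subset {A : Set X} {hc : IsCompact A} {ho : IsOpen A}
    {N : Set (Arrows X)} (hN : IsOpen N) {k : Arrows X} (hk : k ∈ N) (hd : d k ∈ A) (hr : r k ∈ A) :
    ∃ V : Subsemigroup.corner (unitGamma A hc ho),
      k ∈ V.1.carrier ∧ V.1.carrier ⊆ N := by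
  obtain ⟨V, hkV, hV⟩ := exists_gamma_mem_subset
    ((hN.inter (ho.preimage continuous_d)).inter (ho.preimage continuous_r)) ⟨⟨hk, hd⟩, hr⟩
  exact ⟨⟨V, mem_corner_unitGamma.2 fun l hl => ⟨(hV hl).1.2, (hV hl).2⟩⟩, hkV,
    fun l hl => (hV hl).1.1⟩

theorem star_gamma (V : Gamma X) : star V = gammaInv V := by
  refine (eq_star (mul_gammaInv_mul V) ?_).symm
  simpa only [gammaInv_gammaInv] using mul_gammaInv_mul (gammaInv V)

theorem carrier_supp (V : Gamma X) : (supp V).carrier = unit '' (d '' V.carrier) := by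
  rw [supp, star_gamma]
  ext k
  constructor
  · rintro ⟨g, hg, h, hh, e, rfl⟩
    obtain rfl : inv g = h := V.isBisection.injOn_r hg hh e
    refine ⟨_, ⟨_, hh, rfl⟩, ?_⟩
    rw [← inv_comp_self]
    simp only [inv_inv]
  · rintro ⟨_, ⟨g, hg, rfl⟩, rfl⟩
    exact ⟨inv g, by simpa [gammaInv] using hg, g, hg, rfl, inv_comp_self g⟩

theorem supp_eq_unitGamma (V : Gamma X) :
    supp V = unitGamma (d '' V.carrier) (V.isCompact.image continuous_d)
      (isOpenMap_d _ V.isOpen) := Gamma.ext (carrier_supp V)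

/-- Multiplying by a support restricts a bisection to a set of sources. As `d` is injective on `W`,
restricting `W` to the sources of a subset `V` gives back `V`. -/
theorem natLE_gamma_iff (V W : Gamma X) : NatLE V W ↔ V.carrier ⊆ W.carrier := by
  constructor
  · rintro ⟨-, h⟩ k hk
    rw [← h, supp_eq_unitGamma] at hk
    exact (mem_mul_unitGamma.1 hk).1
  · intro h
    constructor
    · rw [supp_eq_unitGamma, supp_eq_unitGamma]
      refine Gamma.ext (Set.ext fun k => mem_mul_unitGamma.trans (and_iff_left_of_imp ?_))
      rintro ⟨_, ⟨g, hg, rfl⟩, rfl⟩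
      exact ⟨g, h hg, rfl⟩
    · rw [supp_eq_unitGamma]
      refine Gamma.ext (Set.ext fun k => mem_mul_unitGamma.trans
        ⟨?_, fun hk => ⟨h hk, k, hk, rfl⟩⟩)
      rintro ⟨hk, g, hg, e⟩
      rwa [← W.isBisection.injOn_d (h hg) hk e]

theorem natLE_corner_gamma_iff {p : Gamma X} (hp : IsIdempotentElem p)
    (V W : Subsemigroup.corner p) :
    haveI := isInverseSemigroup_corner hp
    NatLE V W ↔ V.1.carrier ⊆ W.1.carrier :=
  (natLE_corner_iff hp V W).trans (natLE_gamma_iff _ _)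

/-- The union of two orthogonal compact open bisections. -/
def orthogonalUnion (V W : Gamma X) (h : Orthogonal V W) : Gamma X where
  carrier := V.carrier ∪ W.carrier
  isCompact := V.isCompact.union W.isCompact
  isOpen := V.isOpen.union W.isOpen
  isBisection := by
    -- Orthogonality means disjoint sources and disjoint ranges: a coincidence would yield an arrow
    -- in an empty product.
    have hd : ∀ g ∈ V.carrier, ∀ k ∈ W.carrier, d g ≠ d k := by
      intro g hg k hk e
      have : comp g (inv k) e ∈ (V * star W).carrier :=
        ⟨g, hg, inv k, by rw [star_gamma]; simpa [gammaInv] using hk, e, rfl⟩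
      rw [h.1] at this
      exact this
    have hr : ∀ g ∈ V.carrier, ∀ k ∈ W.carrier, r g ≠ r k := by
      intro g hg k hk e
      have : comp (inv g) k e ∈ (star V * W).carrier :=
        ⟨inv g, by rw [star_gamma]; simpa [gammaInv] using hg, k, hk, e, rfl⟩
      rw [h.2] at this
      exact this
    refine isBisection_of_injOn (V.isOpen.union W.isOpen) ?_ ?_
    · rintro g (hg | hg) k (hk | hk) e
      · exact V.isBisection.injOn_d hg hk e
      · exact (hd g hg k hk e).elim
      · exact (hd k hk g hg e.symm).elim
      · exact W.isBisection.injOn_d hg hk e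
    · rintro g (hg | hg) k (hk | hk) e
      · exact V.isBisection.injOn_r hg hk e
      · exact (hr g hg k hk e).elim
      · exact (hr k hk g hg e.symm).elim
      · exact W.isBisection.injOn_r hg hk e

/-- The union is a bisection by orthogonality and stays in the corner, so it is an upper bound and
the join lies below it. -/
theorem subset_union_of_isJoin_corner {A : Set X} {hc : IsCompact A} {ho : IsOpen A}
    (V W J : Subsemigroup.corner (unitGamma A hc ho)) :
    haveI := isInverseSemigroup_corner (isIdempotentElem_unitGamma A hc ho)
    Orthogonal V W → IsJoin V W J → J.1.carrier ⊆ V.1.carrier ∪ W.1.carrier := by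
  have hp := isIdempotentElem_unitGamma A hc ho
  have := isInverseSemigroup_corner hp
  intro h hJ
  have h' : Orthogonal V.1 W.1 := by
    refine ⟨?_, ?_⟩
    · rw [← coe_star_corner hp]
      exact congrArg Subtype.val h.1
    · rw [← coe_star_corner hp]
      exact congrArg Subtype.val h.2
  let K : Subsemigroup.corner (unitGamma A hc ho) := ⟨orthogonalUnion V.1 W.1 h',
    mem_corner_unitGamma.2 fun k hk => hk.elim (mem_corner_unitGamma.1 V.2 k)
      (mem_corner_unitGamma.1 W.2 k)⟩
  exact (natLE_corner_gamma_iff hp J K).1 (hJ.2.2 K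
    ((natLE_corner_gamma_iff hp V K).2 Set.subset_union_left)
    ((natLE_corner_gamma_iff hp W K).2 Set.subset_union_right))

theorem isJoin_corner_of_carrier_eq {p : Gamma X} (hp : IsIdempotentElem p)
    (V W J : Subsemigroup.corner p) (h : J.1.carrier = V.1.carrier ∪ W.1.carrier) :
    haveI := isInverseSemigroup_corner hp
    IsJoin V W J := by
  have := isInverseSemigroup_corner hp
  refine ⟨(natLE_corner_gamma_iff hp _ _).2 (h ▸ Set.subset_union_left),
    (natLE_corner_gamma_iff hp _ _).2 (h ▸ Set.subset_union_right), fun K hV hW => ?_⟩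
  rw [natLE_corner_gamma_iff hp] at *
  exact h ▸ Set.union_subset hV hW

end

/-! ### Isolated points of orbits -/

section

variable {X : Type u} [Groupoid.{v} X] [TopologicalSpace X] [TopologicalSpace (Arrows X)]
  [IsAmple X]

/-- A basic open set on which `d` is injective contains at most one arrow starting at `x`, and
countably many such sets cover these arrows. -/
theorem countable_orbit [SecondCountableTopology (Arrows X)] (x : X) :
    {y : X | Nonempty (x ≅ y)}.Countable := by
  obtain ⟨b, hbc, -, hb⟩ := TopologicalSpace.exists_countable_basis (Arrows X)
  have hf : ∀ k : Arrows X, d k = x → ∃ B ∈ b, k ∈ B ∧ Set.InjOn d B := by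
    intro k _
    obtain ⟨V, hkV, -⟩ := exists_gamma_mem_subset isOpen_univ (Set.mem_univ k)
    obtain ⟨B, hB, hkB, hBV⟩ := hb.exists_subset_of_mem_open hkV V.isOpen
    exact ⟨B, hB, hkB, V.isBisection.injOn_d.mono hBV⟩
  have hc : (⋃ B ∈ {B ∈ b | Set.InjOn d B}, r '' {k | k ∈ B ∧ d k = x}).Countable := by
    refine (hbc.mono (Set.sep_subset _ _)).biUnion fun B hB =>
      (Set.Subsingleton.image ?_ _).countable
    rintro k ⟨hk, rfl⟩ l ⟨hl, e⟩
    exact hB.2 hk hl e.symm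
  refine hc.mono fun y hy => ?_
  obtain ⟨k, hk, rfl⟩ := nonempty_iso_iff.1 hy
  obtain ⟨B, hB, hkB, hi⟩ := hf k hk
  exact Set.mem_biUnion (show B ∈ {B ∈ b | Set.InjOn d B} from ⟨hB, hi⟩) ⟨k, ⟨hkB, hk⟩, rfl⟩

theorem isOpen_saturation {N : Set X} (hN : IsOpen N) :
    IsOpen {y : X | ∃ z ∈ N, Nonempty (z ≅ y)} := by
  convert isOpenMap_r _ (hN.preimage (continuous_d (X := X))) using 1
  ext y
  constructor
  · rintro ⟨z, hz, h⟩
    obtain ⟨k, rfl, rfl⟩ := nonempty_iso_iff.1 h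
    exact ⟨k, hz, rfl⟩
  · rintro ⟨k, hk, rfl⟩
    exact ⟨d k, hk, nonempty_iso_iff.2 ⟨k, rfl, rfl⟩⟩

variable [T2Space (Arrows X)]

variable (X) in
theorem t2Space_units : T2Space X :=
  (IsTopologicalGroupoid.isEmbedding_unit (X := X)).t2Space

/-- In a second countable ample Hausdorff groupoid with `T₀` orbit space, some point of every orbit
is relatively isolated in it. -/
theorem exists_isolated_mem_orbit [SecondCountableTopology (Arrows X)] [T0Space (OrbitSpace X)]
    (x : X) : ∃ y, Nonempty (x ≅ y) ∧
      ∃ N : Set X, IsOpen N ∧ y ∈ N ∧ ∀ z ∈ N, Nonempty (x ≅ z) → z = y := by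
  have : SecondCountableTopology X :=
    (IsTopologicalGroupoid.isEmbedding_unit (X := X)).secondCountableTopology
  obtain ⟨b, hbc, -, hb⟩ := TopologicalSpace.exists_countable_basis X
  set O : Set X := {y : X | Nonempty (x ≅ y)} with hO
  let C : Set X := closure O
  have := t2Space_units X
  have := locallyCompactSpace_units X
  have : LocallyCompactSpace C := isClosed_closure.locallyCompactSpace
  have hxO : x ∈ O := ⟨Iso.refl x⟩
  by_contra! hcon
  -- A point in all members of `S₁` has an orbit meeting every neighbourhood of `x`; one in all
  -- members of `S₂` avoids the orbit of `x`.
  let S₁ : Set (Set C) := (fun B => {c : C | ∃ z ∈ B, Nonempty (z ≅ c.1)}) '' {B ∈ b | x ∈ B}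
  let S₂ : Set (Set C) := (fun y => {c : C | c.1 ≠ y}) '' O
  have hdO : Dense {c : C | c.1 ∈ O} := by
    intro c
    rw [closure_subtype]
    convert c.2
    ext y
    constructor
    · rintro ⟨c, hc, rfl⟩
      exact hc
    · intro hy
      exact ⟨⟨y, subset_closure hy⟩, hy, rfl⟩
  have hD : Dense (⋂₀ (S₁ ∪ S₂)) := by
    refine dense_sInter_of_isOpen ?_ ?_ ?_
    · rintro _ (⟨B, ⟨hB, -⟩, rfl⟩ | ⟨y, -, rfl⟩)
      · exact (isOpen_saturation (hb.isOpen hB)).preimage continuous_subtype_val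
      · exact isOpen_ne.preimage continuous_subtype_val
    · exact ((hbc.mono (Set.sep_subset _ _)).image _).union ((countable_orbit x).image _)
    · rintro _ (⟨B, ⟨-, hB⟩, rfl⟩ | ⟨y, hy, rfl⟩)
      · exact hdO.mono fun c hc => ⟨x, hB, hc⟩
      · have he : {c : C | c.1 ≠ y} = {(⟨y, subset_closure hy⟩ : C)}ᶜ := by
          ext c
          simp [Subtype.ext_iff]
        simp only [he]
        -- If `{y}` were open in `C`, then `y` would be isolated in the orbit, against `hcon`.
        rw [dense_compl_singleton_iff_not_open]
        intro ho
        obtain ⟨N, hN, hNe⟩ := isOpen_induced_iff.1 ho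
        have hyN : y ∈ N := by
          have : (⟨y, subset_closure hy⟩ : C) ∈ Subtype.val ⁻¹' N := by
            rw [hNe]
            rfl
          exact this
        obtain ⟨z, hz, hz', hzy⟩ := hcon y hy N hN hyN
        have : (⟨z, subset_closure hz'⟩ : C) ∈ Subtype.val ⁻¹' N := hz
        rw [hNe] at this
        exact hzy (congrArg Subtype.val this)
  have : Nonempty C := ⟨⟨x, subset_closure hxO⟩⟩
  obtain ⟨c, hc⟩ := hD.nonempty
  have hcO : c.1 ∉ O := fun h => hc _ (Or.inr ⟨c.1, h, rfl⟩) rfl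
  have hq : (⟦x⟧ : OrbitSpace X) = ⟦c.1⟧ := by
    -- One direction uses the sets in `S₁`, the other that `c` lies in the closure of the orbit.
    refine (inseparable_iff_forall_isOpen.2 fun s hs => ⟨fun h => ?_, fun h => ?_⟩).eq
    · have hs' : IsOpen ((fun y : X => (⟦y⟧ : OrbitSpace X)) ⁻¹' s) :=
        hs.preimage continuous_quotient_mk'
      obtain ⟨B, hB, hxB, hBs⟩ := hb.exists_subset_of_mem_open h hs'
      obtain ⟨z, hz, hzc⟩ := hc _ (Or.inl ⟨B, ⟨hB, hxB⟩, rfl⟩)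
      have : (⟦z⟧ : OrbitSpace X) ∈ s := hBs hz
      rwa [Quotient.sound (s := isIsomorphicSetoid X) hzc] at this
    · have hs' : IsOpen ((fun y : X => (⟦y⟧ : OrbitSpace X)) ⁻¹' s) :=
        hs.preimage continuous_quotient_mk'
      obtain ⟨z, hz, hzO⟩ := mem_closure_iff.1 c.2 _ hs' h
      rw [Quotient.sound (s := isIsomorphicSetoid X) hzO]
      exact hz
  exact hcO (Quotient.exact hq)

/-- Isolation moves along a bisection `V` through an arrow `g` from `x` to the isolated point. If
`k` goes from `x` into `A ⊆ d '' V`, following it by an arrow `h` of `V` lands at the isolated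
point. Hence `h = g`, and `k` ends at `x`. -/
theorem exists_isCompact_isOpen_inter_orbit [SecondCountableTopology (Arrows X)]
    [T0Space (OrbitSpace X)] (x : X) : ∃ A : Set X, IsCompact A ∧ IsOpen A ∧ x ∈ A ∧
      ∀ k : Arrows X, d k = x → r k ∈ A → r k = x := by
  obtain ⟨y, hxy, N, hN, hyN, hNy⟩ := exists_isolated_mem_orbit x
  obtain ⟨g, hg, rfl⟩ := nonempty_iso_iff.1 hxy
  obtain ⟨V, hgV, hV⟩ := exists_gamma_mem_subset (hN.preimage (continuous_r (X := X))) (k := g) hyN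
  obtain ⟨A, hAc, hAo, hxA, hA⟩ := exists_isCompact_isOpen_subset (isOpenMap_d _ V.isOpen)
    (x := x) ⟨g, hgV, hg⟩
  refine ⟨A, hAc, hAo, hxA, fun k hk hkA => ?_⟩
  obtain ⟨h, hhV, hhk⟩ := hA hkA
  have : r h = r g := hNy _ (hV hhV)
    (nonempty_iso_iff.2 ⟨comp h k hhk, hk, rfl⟩)
  rw [← hhk, V.isBisection.injOn_r hhV hgV this, hg]

/-! ### The isotropy group as a quotient of a corner -/

theorem mul_mem_corner {A : Set X} {hc : IsCompact A} {ho : IsOpen A} {x : X}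
    {V W : Subsemigroup.corner (unitGamma A hc ho)} {g h : Isotropy x}
    (hg : isotropyArrow g ∈ V.1.carrier) (hh : isotropyArrow h ∈ W.1.carrier) :
    isotropyArrow (g * h) ∈ (V * W).1.carrier :=
  ⟨_, hg, _, hh, rfl, (isotropyArrow_mul g h).symm⟩

theorem isQuotientOfCorner_isotropy [SecondCountableTopology (Arrows X)] [T0Space (OrbitSpace X)]
    (x : X) : IsQuotientOfCorner (WithZero (Isotropy x)) (Gamma X) := by
  classical
  obtain ⟨A, hc, ho, hxA, hA⟩ := exists_isCompact_isOpen_inter_orbit x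
  have hp := isIdempotentElem_unitGamma A hc ho
  refine ⟨unitGamma A hc ho, hp, ?_⟩
  have := isInverseSemigroup_corner hp
  let f : Subsemigroup.corner (unitGamma A hc ho) → WithZero (Isotropy x) := fun V =>
    if h : ∃ g : Isotropy x, isotropyArrow g ∈ V.1.carrier then ↑h.choose else 0
  have hf : ∀ (V) (g : Isotropy x), isotropyArrow g ∈ V.1.carrier → f V = g := by
    intro V g hg
    have h : ∃ g : Isotropy x, isotropyArrow g ∈ V.1.carrier := ⟨g, hg⟩
    have : h.choose = g :=
      isotropyArrow_injective x (V.1.isBisection.injOn_d h.choose_spec hg rfl)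
    simp only [f, dif_pos h, this]
  have hf0 : ∀ V, (¬ ∃ g : Isotropy x, isotropyArrow g ∈ V.1.carrier) → f V = 0 :=
    fun V h => dif_neg h
  have hf0' : ∀ V, f V = 0 → ¬ ∃ g : Isotropy x, isotropyArrow g ∈ V.1.carrier := by
    rintro V h ⟨g, hg⟩
    exact WithZero.coe_ne_zero ((hf V g hg).symm.trans h)
  have hmul : ∀ V W, f (V * W) = f V * f W := by
    intro V W
    by_cases h : ∃ k : Isotropy x, isotropyArrow k ∈ (V * W).1.carrier
    · obtain ⟨k, hk⟩ := h
      obtain ⟨g, hg, h, hh, e, he⟩ := hk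
      have hdh : d h = x := congrArg d he
      have hrg : r g = x := congrArg r he
      -- The choice of `A` enters here: `h` starts at `x` and ends in `A`, so both factors of an
      -- isotropy arrow are isotropy arrows.
      have hrh : r h = x := hA h hdh (mem_corner_unitGamma.1 W.2 h hh).2
      obtain ⟨g, rfl⟩ := exists_isotropyArrow_eq (e.trans hrh) hrg
      obtain ⟨h, rfl⟩ := exists_isotropyArrow_eq hdh hrh
      rw [hf _ _ (mul_mem_corner hg hh), hf _ _ hg, hf _ _ hh, WithZero.coe_mul]
    · rw [hf0 _ h]
      by_cases hV : ∃ g : Isotropy x, isotropyArrow g ∈ V.1.carrier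
      · have hW : ¬ ∃ g : Isotropy x, isotropyArrow g ∈ W.1.carrier := by
          rintro ⟨k, hk⟩
          exact h ⟨_, mul_mem_corner hV.choose_spec hk⟩
        rw [hf0 W hW, mul_zero]
      · rw [hf0 V hV, zero_mul]
  have h0 : f 0 = 0 := hf0 _ (by rintro ⟨g, hg⟩; exact hg)
  refine ⟨⟨f, hmul⟩, isBooleanMorphism_withZero _ h0 ?_, ?_⟩
  · intro V W J hVW hJ hV hW
    refine hf0 _ ?_
    rintro ⟨g, hg⟩
    rcases subset_union_of_isJoin_corner V W J hVW hJ hg with h | h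
    · exact hf0' V hV ⟨g, h⟩
    · exact hf0' W hW ⟨g, h⟩
  · intro a
    induction a with
    | zero => exact ⟨0, h0⟩
    | coe g =>
      obtain ⟨V, hgV, -⟩ := exists_corner_mem_subset (hc := hc) (ho := ho) isOpen_univ
        (Set.mem_univ (isotropyArrow g)) hxA hxA
      exact ⟨V, hf V g hgV⟩

/-! ### From a quotient of a corner to a quotient of an isotropy group -/

/-- A compact open subset of `A`, as an element of the corner at `A`. -/
def unitCorner {A : Set X} (hc : IsCompact A) (ho : IsOpen A) (E : Set X) (hEc : IsCompact E)
    (hEo : IsOpen E) (hE : E ⊆ A) : Subsemigroup.corner (unitGamma A hc ho) :=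
  ⟨unitGamma E hEc hEo, mem_corner_unitGamma.2 (by
    rintro _ ⟨x, hx, rfl⟩
    exact ⟨hE hx, hE hx⟩)⟩

/-- A morphism from a corner onto a group with zero restricts, on sets of units, to the membership
of a point. -/
theorem exists_point_of_isBooleanMorphism {G : Type w} [Group G] {A : Set X} (hc : IsCompact A)
    (ho : IsOpen A) (φ : Subsemigroup.corner (unitGamma A hc ho) →ₙ* WithZero G) :
    haveI := isInverseSemigroup_corner (isIdempotentElem_unitGamma A hc ho)
    IsBooleanMorphism φ → Function.Surjective φ →
    ∃ x ∈ A, ∀ (E : Set X) (hEc : IsCompact E) (hEo : IsOpen E) (hE : E ⊆ A),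
      φ (unitCorner hc ho E hEc hEo hE) ≠ 0 ↔ x ∈ E := by
  have hp := isIdempotentElem_unitGamma A hc ho
  have := isInverseSemigroup_corner hp
  have := t2Space_units X
  intro hφ hs
  have hinter : ∀ (E F : Set X) (hEc : IsCompact E) (hEo : IsOpen E) (hE : E ⊆ A)
      (hFc : IsCompact F) (hFo : IsOpen F) (hF : F ⊆ A) (hIc : IsCompact (E ∩ F)),
      φ (unitCorner hc ho E hEc hEo hE) * φ (unitCorner hc ho F hFc hFo hF) =
        φ (unitCorner hc ho (E ∩ F) hIc (hEo.inter hFo) (Set.inter_subset_left.trans hE)) := by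
    intro E F hEc hEo hE hFc hFo hF hIc
    rw [← map_mul]
    congr 1
    refine Subtype.ext (Gamma.ext (Set.ext fun k =>
      (mem_unitGamma_mul (hc := hEc) (ho := hEo)).trans ?_))
    constructor
    · rintro ⟨⟨y, hy, rfl⟩, hy'⟩
      exact ⟨y, ⟨hy', hy⟩, rfl⟩
    · rintro ⟨y, hy, rfl⟩
      exact ⟨⟨y, hy.2, rfl⟩, hy.1⟩
  have hempty : ∀ (E : Set X) (hEc : IsCompact E) (hEo : IsOpen E) (hE : E ⊆ A), E = ∅ →
      φ (unitCorner hc ho E hEc hEo hE) = 0 := by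
    rintro E hEc hEo hE rfl
    rw [← hφ.map_zero]
    congr 1
    exact Subtype.ext (Gamma.ext (Set.image_empty _))
  -- The whole of `A` is the identity of the corner; killing it would kill everything, while `1` is
  -- attained.
  have htop : φ (unitCorner hc ho A hc ho subset_rfl) ≠ 0 := by
    intro h
    obtain ⟨V, hV⟩ := hs 1
    have : unitCorner hc ho A hc ho subset_rfl * V = V :=
      Subtype.ext ((Subsemigroup.mem_corner_iff hp).1 V.2).1
    rw [← this, map_mul, h, zero_mul] at hV
    exact zero_ne_one hV
  have hunion : ∀ (E F : Set X) (hEc : IsCompact E) (hEo : IsOpen E) (hE : E ⊆ A)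
      (hFc : IsCompact F) (hFo : IsOpen F) (hF : F ⊆ A),
      φ (unitCorner hc ho E hEc hEo hE) = 0 → φ (unitCorner hc ho F hFc hFo hF) = 0 →
      φ (unitCorner hc ho (E ∪ F) (hEc.union hFc) (hEo.union hFo)
        (Set.union_subset hE hF)) = 0 := by
    intro E F hEc hEo hE hFc hFo hF hE0 hF0
    -- Morphisms control only orthogonal joins, so the union is split into `E` and `F \ E`.
    have hDo : IsOpen (F \ E) := hFo.sdiff hEc.isClosed
    have hDc : IsCompact (F \ E) := hFc.diff hEo
    let e := unitCorner hc ho E hEc hEo hE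
    let k := unitCorner hc ho (F \ E) hDc hDo (Set.sdiff_subset.trans hF)
    have hk0 : φ k = 0 := by
      have h := hinter F (F \ E) hFc hFo hF hDc hDo (Set.sdiff_subset.trans hF)
        (by rwa [Set.inter_eq_right.2 Set.sdiff_subset])
      rw [hF0, zero_mul] at h
      rw [h]
      simp only [k, Set.inter_eq_right.2 Set.sdiff_subset]
    have hek : Orthogonal e k := by
      have hst : ∀ (D : Set X) (hDc : IsCompact D) (hDo : IsOpen D) (hD : D ⊆ A),
          star (unitCorner hc ho D hDc hDo hD) = unitCorner hc ho D hDc hDo hD := by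
        intro D hDc hDo hD
        have h := isIdempotentElem_unitGamma D hDc hDo
        have h' : unitCorner hc ho D hDc hDo hD * unitCorner hc ho D hDc hDo hD =
          unitCorner hc ho D hDc hDo hD := Subtype.ext h
        exact (eq_star (by rw [h', h']) (by rw [h', h'])).symm
      have hz : e * k = 0 := by
        refine Subtype.ext (Gamma.ext (Set.eq_empty_of_forall_notMem fun l hl => ?_))
        obtain ⟨⟨y, hy, rfl⟩, hy'⟩ := (mem_unitGamma_mul (hc := hEc) (ho := hEo)).1 hl
        exact hy.2 hy'
      constructor
      · rw [hst]; exact hz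
      · rw [hst]; exact hz
    have hj := hφ.map_join e k (unitCorner hc ho (E ∪ F) (hEc.union hFc) (hEo.union hFo)
      (Set.union_subset hE hF)) hek (isJoin_corner_of_carrier_eq hp _ _ _ (by
        change unit '' (E ∪ F) = unit '' E ∪ unit '' (F \ E)
        rw [← Set.image_union, Set.union_sdiff_self]))
    rw [hk0, show φ e = 0 from hE0] at hj
    exact (hj.2.2.2 0 (natLE_rfl 0) (natLE_rfl 0)).eq_zero
  have hpt : ∃ x ∈ A, ∀ (E : Set X) (hEc : IsCompact E) (hEo : IsOpen E) (hE : E ⊆ A),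
      x ∈ E → φ (unitCorner hc ho E hEc hEo hE) ≠ 0 := by
    -- Otherwise killed sets cover `A`. By compactness and closure under unions, `A` itself is
    -- killed.
    by_contra! hcon
    have : ∃ (E : Set X) (hEc : IsCompact E) (hEo : IsOpen E) (hE : E ⊆ A),
        A ⊆ E ∧ φ (unitCorner hc ho E hEc hEo hE) = 0 := by
      refine hc.induction_on (p := fun s => ∃ (E : Set X) (hEc : IsCompact E) (hEo : IsOpen E)
        (hE : E ⊆ A), s ⊆ E ∧ φ (unitCorner hc ho E hEc hEo hE) = 0) ?_ ?_ ?_ ?_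
      · exact ⟨∅, isCompact_empty, isOpen_empty, Set.empty_subset _, subset_rfl,
          hempty _ _ _ _ rfl⟩
      · rintro s t hst ⟨E, hEc, hEo, hE, h, h'⟩
        exact ⟨E, hEc, hEo, hE, hst.trans h, h'⟩
      · rintro s t ⟨E, hEc, hEo, hE, h, h'⟩ ⟨F, hFc, hFo, hF, k, k'⟩
        exact ⟨E ∪ F, _, _, _, Set.union_subset_union h k,
          hunion E F hEc hEo hE hFc hFo hF h' k'⟩
      · intro x hx
        obtain ⟨E, hEc, hEo, hE, hxE, h⟩ := hcon x hx
        exact ⟨E, mem_nhdsWithin_of_mem_nhds (hEo.mem_nhds hxE), E, hEc, hEo, hE, subset_rfl, h⟩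
    obtain ⟨E, hEc, hEo, hE, h, h'⟩ := this
    obtain rfl := h.antisymm hE
    exact htop h'
  obtain ⟨x, hxA, hx⟩ := hpt
  refine ⟨x, hxA, fun E hEc hEo hE => ⟨fun h => ?_, hx E hEc hEo hE⟩⟩
  by_contra hxE
  -- If `x ∉ E`, then `A \ E` contains `x` and is not killed. Its product with `E` is zero, so `E`
  -- must be killed.
  have hDo : IsOpen (A \ E) := ho.sdiff hEc.isClosed
  have hDc : IsCompact (A \ E) := hc.diff hEo
  have hd : E ∩ (A \ E) = ∅ := Set.inter_sdiff_self E A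
  have h₁ := hinter E (A \ E) hEc hEo hE hDc hDo Set.sdiff_subset
    (hd ▸ isCompact_empty)
  rw [hempty (E ∩ (A \ E)) _ _ _ hd] at h₁
  exact (mul_ne_zero h (hx _ hDc hDo Set.sdiff_subset ⟨hxA, hxE⟩)) h₁

theorem exists_surjective_of_isQuotientOfCorner (G : Type w) [Group G]
    (h : IsQuotientOfCorner (WithZero G) (Gamma X)) :
    ∃ (x : X) (φ : Isotropy x →* G), Function.Surjective φ := by
  obtain ⟨p, hp, φ, hφ, hs⟩ := h
  obtain ⟨A, hc, ho, rfl⟩ := exists_eq_unitGamma hp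
  have := isInverseSemigroup_corner hp
  have := t2Space_units X
  obtain ⟨x, hxA, hx⟩ := exists_point_of_isBooleanMorphism hc ho φ hφ hs
  have hsupp : ∀ V, φ (supp V) ≠ 0 ↔ x ∈ d '' V.1.carrier := by
    intro V
    have hV : d '' V.1.carrier ⊆ A := by
      rintro _ ⟨k, hk, rfl⟩
      exact (mem_corner_unitGamma.1 V.2 k hk).1
    rw [← hx _ (V.1.isCompact.image continuous_d) (isOpenMap_d _ V.1.isOpen) hV]
    have : supp V = unitCorner hc ho (d '' V.1.carrier) (V.1.isCompact.image continuous_d)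
        (isOpenMap_d _ V.1.isOpen) hV :=
      Subtype.ext ((coe_supp_corner hp V).trans (supp_eq_unitGamma _))
    rw [this]
  have hne : ∀ V, φ V ≠ 0 ↔ x ∈ d '' V.1.carrier := by
    intro V
    rw [← hsupp, map_supp, not_iff_not]
    constructor
    · intro h
      rw [h, supp_zero_withZero]
    · intro h
      by_contra h'
      rw [supp_withZero h'] at h
      exact one_ne_zero h
  have hiso : ∀ V, φ V ≠ 0 → ∃ g : Isotropy x, isotropyArrow g ∈ V.1.carrier := by
    intro V hV
    obtain ⟨k, hk, hd⟩ := (hne V).1 hV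
    suffices hr : r k = x by
      obtain ⟨g, rfl⟩ := exists_isotropyArrow_eq hd hr
      exact ⟨g, hk⟩
    by_contra hr
    -- If `r k ≠ x`, restrict the ranges of `V` to a neighbourhood `E` of `x` missing `r k`. The
    -- image stays nonzero, so an arrow from `x` survives; by injectivity of `d` it is `k`, whose
    -- range is not in `E`.
    obtain ⟨E, hEc, hEo, hxE, hE⟩ := exists_isCompact_isOpen_subset
      (ho.inter (isOpen_compl_singleton (x := r k))) (x := x) ⟨hxA, Ne.symm hr⟩
    have h₁ := (hx E hEc hEo (hE.trans Set.inter_subset_left)).2 hxE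
    have h₂ := mul_ne_zero h₁ hV
    rw [← map_mul, hne] at h₂
    obtain ⟨l, hl, hld⟩ := h₂
    obtain ⟨hlV, hlE⟩ := (mem_unitGamma_mul (hc := hEc) (ho := hEo)).1 hl
    rw [V.1.isBisection.injOn_d hlV hk (hld.trans hd.symm)] at hlE
    exact (hE hlE).2 rfl
  have hgerm : ∀ g : Isotropy x, ∃ a : G, ∀ V, isotropyArrow g ∈ V.1.carrier → φ V = a := by
    intro g
    have hle : ∀ V W, isotropyArrow g ∈ W.1.carrier → W.1.carrier ⊆ V.1.carrier → φ V = φ W := by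
      intro V W hW hWV
      exact (((natLE_corner_gamma_iff hp W V).2 hWV).map φ).eq_of_ne_zero
        ((hne W).2 ⟨_, hW, rfl⟩)
    obtain ⟨V, hV, -⟩ := exists_corner_mem_subset (hc := hc) (ho := ho) isOpen_univ
      (Set.mem_univ (isotropyArrow g)) hxA hxA
    obtain ⟨a, ha⟩ := WithZero.ne_zero_iff_exists.1 ((hne V).2 ⟨_, hV, rfl⟩)
    refine ⟨a, fun V' hV' => ?_⟩
    -- Two bisections through the same arrow share a smaller one `W`. Its image is nonzero, so
    -- flatness makes all three images equal.
    obtain ⟨W, hgW, hW⟩ := exists_corner_mem_subset (hc := hc) (ho := ho)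
      (V.1.isOpen.inter V'.1.isOpen) (k := isotropyArrow g) ⟨hV, hV'⟩ hxA hxA
    rw [hle V' W hgW (hW.trans Set.inter_subset_right),
      ← hle V W hgW (hW.trans Set.inter_subset_left), ha]
  choose ψ hψ using hgerm
  refine ⟨x, MonoidHom.mk' ψ fun g h => ?_, fun a => ?_⟩
  · obtain ⟨V, hV, -⟩ := exists_corner_mem_subset (hc := hc) (ho := ho) isOpen_univ
      (Set.mem_univ (isotropyArrow g)) hxA hxA
    obtain ⟨W, hW, -⟩ := exists_corner_mem_subset (hc := hc) (ho := ho) isOpen_univ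
      (Set.mem_univ (isotropyArrow h)) hxA hxA
    rw [← WithZero.coe_inj, WithZero.coe_mul, ← hψ g V hV, ← hψ h W hW, ← map_mul,
      hψ (g * h) (V * W) (mul_mem_corner hV hW)]
  · obtain ⟨V, hV⟩ := hs a
    obtain ⟨g, hg⟩ := hiso V (by rw [hV]; exact WithZero.coe_ne_zero)
    refine ⟨g, ?_⟩
    rw [← WithZero.coe_inj, ← hV]
    exact (hψ g V hg).symm

end

end AmpleGroupoid

open AmpleGroupoid InverseSemigroup in
theorem mainTheorem7 (X : Type u) [Groupoid.{v} X] [TopologicalSpace X]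
    [TopologicalSpace (Arrows X)] [IsAmple X] [T2Space (Arrows X)] :
    (∀ [SecondCountableTopology (Arrows X)] [T0Space (OrbitSpace X)] (x : X),
      IsQuotientOfCorner (WithZero (Isotropy x)) (Gamma X)) ∧
    (∀ (G : Type w) [Group G], IsQuotientOfCorner (WithZero G) (Gamma X) →
      ∃ (x : X) (φ : Isotropy x →* G), Function.Surjective φ) :=
  ⟨fun x => isQuotientOfCorner_isotropy x, fun G _ h => exists_surjective_of_isQuotientOfCorner G h⟩
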